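/- Consider a network of $n$ agents over a weighted undirected graph with nonnegative adjacency weights $a_{i,j}=a_{j,i}$. Let $\Omega_i\subset\mathbb R^{q_i}$, let $f^i:U_i\to\mathbb R$ with $U_i\subset\mathbb R^{q_i}$ open and convex and $\Omega_i\subset U_i$, let $W_i\in\mathbb R^{m\times q_i}$, $d_0\in\mathbb R^m$, and put $\Omega=\prod_{i=1}^n\Omega_i$. The distributed extended monotropic optimization (EMO) problem is $$\min_{x=(x_1,\dots,x_n)}\ \sum_{i=1}^n f^i(x_i)\quad\text{subject to}\quad \sum_{i=1}^n W_i x_i=d_0,\quad x_i\in\Omega_i,\ i=1,\dots,n.$$ Assume: (1) the graph is connected; (2) for every $i$, $f^i$ is strictly convex on $U_i$ and $\Omega_i$ is closed and convex; (3) (Slater) there is an interior point $x$ of $\Omega$ with $\sum_i W_ix_i=d_0$. Assume also that the EMO problem has an optimal solution. Let $d_1,\dots,d_n\in\mathbb R^m$ with $\sum_{i=1}^n d_i=d_0$, and consider the distributed projected output feedback algorithm (DPOFA): for $i=1,\dots,n$ and $t\ge 0$, $$\begin{aligned} \dot y_i(t)&\in\{-y_i(t)+x_i(t)-g+W_i^{\mathrm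 T}\lambda_i(t):\ g\in\partial f^i(x_i(t))\},\\ \dot\lambda_i(t)&=d_i-W_ix_i(t)-\sum_{j=1}^n a_{i,j}(\lambda_i(t)-\lambda_j(t))-\sum_{j=1}^n a_{i,j}(z_i(t)-z_j(t)),\\ \dot z_i(t)&=\sum_{j=1}^n a_{i,j}(\lambda_i(t)-\lambda_j(t)),\\ x_i(t)&=P_{\Omega_i}(y_i(t)), \end{aligned}$$ with arbitrary initial values $y_i(0)\in\mathbb R^{q_i}$, $\lambda_i(0),z_i(0)\in\mathbb R^m$. Here $\partial f^i(u)=\{p:\langle p,v-u\rangle\le f^i(v)-f^i(u)\ \forall v\in U_i\}$ is the subdifferential and $P_{\Omega_i}$ the Euclidean projection onto $\Omega_i$. A solution is a tuple $(y,x,\lambda,z)$ of functions on $[0,\infty)$ with $x_i(t)=P_{\Omega_i}(y_i(t))$ for all $t\ge0$, such that $(y,\lambda,z)$ is absolutely continuous on every compact interval $[0,T]$ and satisfies the inclusion for almost all $t\ge0$. Then the optimal solution $x^*$ of the EMO problem is unique, and (i) every solution $(y(t),x(t),\lambda(t),z(t))$ is bounded on $[0,\infty)$; (ii) for every solution, $x(t)\to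 x^*$ as $t\to\infty$. -/

import Mathlib

open MeasureTheory Filter Topology
open scoped RealInnerProductSpace

/-- `ℝ^k` with the Euclidean norm. -/
abbrev Vec (k : ℕ) : Type := EuclideanSpace ℝ (Fin k)

/-- Stacked vectors `[x_1ᵀ, …, x_nᵀ]ᵀ` with `x_i ∈ ℝ^{q_i}`, with the Euclidean norm. -/
abbrev Stacked {n : ℕ} (q : Fin n → ℕ) : Type := PiLp 2 (fun i : Fin n => Vec (q i))

/-- A weighted undirected graph on the nodes `1, …, n`, given by its symmetric nonnegative weighted
adjacency matrix `[a_{i,j}]`. Self-loops are allowed, they play no role. -/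
structure WeightedGraph (n : ℕ) where
  a : Matrix (Fin n) (Fin n) ℝ
  symm : ∀ i j, a i j = a j i
  nonneg : ∀ i j, 0 ≤ a i j

/-- The underlying simple graph: two distinct nodes are adjacent when their weight is positive. -/
def WeightedGraph.toSimpleGraph {n : ℕ} (G : WeightedGraph n) : SimpleGraph (Fin n) where
  Adj i j := i ≠ j ∧ 0 < G.a i j
  symm := ⟨fun i j h => ⟨h.1.symm, G.symm i j ▸ h.2⟩⟩
  loopless := ⟨fun _ h => h.1 rfl⟩

/-- The data of a distributed extended monotropic optimization problem
`min ∑ f^i(x_i)` subject to `∑ W_i x_i = d_0`, `x_i ∈ Ω_i`, over a network of `n` agents. -/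
structure EMOProblem (n m : ℕ) (q : Fin n → ℕ) where
  /-- The communication graph. -/
  graph : WeightedGraph n
  /-- The local feasible sets. -/
  Ω : ∀ i, Set (Vec (q i))
  /-- The set on which `f^i` is defined; values of `f i` elsewhere are irrelevant. -/
  U : ∀ i, Set (Vec (q i))
  /-- The local objective functions. -/
  f : ∀ i, Vec (q i) → ℝ
  /-- The blocks of the constraint matrix. -/
  W : ∀ i, Matrix (Fin m) (Fin (q i)) ℝ
  d₀ : Vec m

/-- `p` is a subgradient at `x` of the function `f` with domain `U`. -/
def IsSubgradient {k : ℕ} (U : Set (Vec k)) (f : Vec k → ℝ) (x p : Vec k) : Prop :=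
  ∀ y ∈ U, ⟪p, y - x⟫ ≤ f y - f x

/-- `v = P_Ω(u)`: `v` is the point of `Ω` that minimizes the distance to `u`. For nonempty closed
convex `Ω` there is exactly one such `v`, see `existsUnique_isProjection`. -/
def IsProjection {k : ℕ} (Ω : Set (Vec k)) (u v : Vec k) : Prop :=
  v ∈ Ω ∧ ∀ w ∈ Ω, ‖u - v‖ ≤ ‖u - w‖

theorem existsUnique_isProjection {k : ℕ} {Ω : Set (Vec k)} (hne : Ω.Nonempty)
    (hcl : IsClosed Ω) (hconv : Convex ℝ Ω) (u : Vec k) : ∃! v, IsProjection Ω u v := by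
  have key : ∀ v, IsProjection Ω u v → ∀ w ∈ Ω, ⟪u - v, w - v⟫ ≤ 0 := by
    rintro v ⟨hv, hmin⟩
    refine (norm_eq_iInf_iff_real_inner_le_zero hconv hv).1 (le_antisymm ?_ ?_)
    · have : Nonempty Ω := ⟨⟨v, hv⟩⟩
      exact le_ciInf fun w => hmin w w.2
    · exact ciInf_le ⟨0, by rintro _ ⟨w, rfl⟩; exact norm_nonneg _⟩ (⟨v, hv⟩ : Ω)
  obtain ⟨v, hv, h⟩ := exists_norm_eq_iInf_of_complete_convex hne hcl.isComplete hconv u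
  have hP : IsProjection Ω u v := by
    refine ⟨hv, fun w hw => ?_⟩
    rw [h]
    exact ciInf_le ⟨0, by rintro _ ⟨w, rfl⟩; exact norm_nonneg _⟩ (⟨w, hw⟩ : Ω)
  refine ⟨v, hP, fun v' hP' => ?_⟩
  have h1 := key v hP v' hP'.1
  have h2 := key v' hP' v hv
  have h3 : ⟪v' - v, v' - v⟫ = ⟪u - v, v' - v⟫ + ⟪u - v', v - v'⟫ := by
    simp only [inner_sub_left, inner_sub_right]
    ring
  have h4 : ⟪v' - v, v' - v⟫ = 0 :=
    le_antisymm (by linarith) real_inner_self_nonneg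
  exact sub_eq_zero.1 (inner_self_eq_zero.1 h4)

namespace EMOProblem

variable {n m : ℕ} {q : Fin n → ℕ}

/-- `Ω = ∏ Ω_i`. -/
def prodΩ (P : EMOProblem n m q) : Set (Stacked q) := {x | ∀ i, x i ∈ P.Ω i}

/-- `f(x) = ∑ f^i(x_i)`. -/
noncomputable def objective (P : EMOProblem n m q) (x : Stacked q) : ℝ := ∑ i, P.f i (x i)

/-- `W x = ∑ W_i x_i`. -/
noncomputable def constraintMap (P : EMOProblem n m q) (x : Stacked q) : Vec m :=
  ∑ i, (P.W i).toEuclideanLin (x i)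

/-- The feasible set `{x ∈ Ω : W x = d_0}`. -/
def feasible (P : EMOProblem n m q) : Set (Stacked q) :=
  {x | x ∈ P.prodΩ ∧ P.constraintMap x = P.d₀}

/-- `x` is an optimal solution. -/
def IsOptimal (P : EMOProblem n m q) (x : Stacked q) : Prop :=
  x ∈ P.feasible ∧ IsMinOn P.objective P.feasible x

/-- The standing assumption: connected (undirected) graph, objective functions strictly convex on
open sets containing the closed convex sets `Ω_i`, and Slater's condition. -/
structure StandingAssumption (P : EMOProblem n m q) : Prop where
  connected : P.graph.toSimpleGraph.Connected
  isOpen_U : ∀ i, IsOpen (P.U i)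
  subset_U : ∀ i, P.Ω i ⊆ P.U i
  strictConvex : ∀ i, StrictConvexOn ℝ (P.U i) (P.f i)
  isClosed_Ω : ∀ i, IsClosed (P.Ω i)
  convex_Ω : ∀ i, Convex ℝ (P.Ω i)
  slater : ∃ x ∈ interior P.prodΩ, P.constraintMap x = P.d₀

/-- `(y, x, λ, z)` is a solution on `[0, ∞)` of the distributed projected output feedback algorithm
with parameters `d_1, …, d_n`: the state `(y, λ, z)` is absolutely continuous on compact
subintervals of `[0, ∞)` and satisfies the differential inclusion for almost all `t ≥ 0`, with
`x_i(t) = P_{Ω_i}(y_i(t))` for all `t ≥ 0`. Initial values are arbitrary. -/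
structure IsDPOFASolution (P : EMOProblem n m q) (d : Fin n → Vec m)
    (y x : ℝ → Stacked q) (lam z : ℝ → Stacked (fun _ : Fin n => m)) : Prop where
  ac_y : ∀ T : ℝ, 0 < T → AbsolutelyContinuousOnInterval y 0 T
  ac_lam : ∀ T : ℝ, 0 < T → AbsolutelyContinuousOnInterval lam 0 T
  ac_z : ∀ T : ℝ, 0 < T → AbsolutelyContinuousOnInterval z 0 T
  output : ∀ t : ℝ, 0 ≤ t → ∀ i, IsProjection (P.Ω i) (y t i) (x t i)
  deriv_y : ∀ᵐ t ∂(volume.restrict (Set.Ici (0 : ℝ))), ∀ i,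
    ∃ g : Vec (q i), IsSubgradient (P.U i) (P.f i) (x t i) g ∧
      HasDerivAt (fun s => y s i)
        (-(y t i) + x t i - g + ((P.W i).transpose).toEuclideanLin (lam t i)) t
  deriv_lam : ∀ᵐ t ∂(volume.restrict (Set.Ici (0 : ℝ))), ∀ i,
    HasDerivAt (fun s => lam s i)
      (d i - (P.W i).toEuclideanLin (x t i)
        - ∑ j, P.graph.a i j • (lam t i - lam t j)
        - ∑ j, P.graph.a i j • (z t i - z t j)) t
  deriv_z : ∀ᵐ t ∂(volume.restrict (Set.Ici (0 : ℝ))), ∀ i,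
    HasDerivAt (fun s => z s i) (∑ j, P.graph.a i j • (lam t i - lam t j)) t

end EMOProblem

/-! Slater's condition provides a subgradient g* at the optimum x* and a multiplier μ
(`exists_multiplier_of_isMinOn`). Put λ* = (μ, …, μ), which the graph Laplacian L annihilates, and
choose z* with L z* = d − (W_i x*_i)_i; connectedness makes this solvable, since the blocks on the
right sum to zero. Then x* is the output of an equilibrium.

The Lyapunov function is ½|λ − λ*|² + ½|z − z*|² + ½(|y − x*|² − |y − P y|²). Its last term is
differentiable with gradient P y − x*, although the projection P is merely Lipschitz. Along a
solution the skew couplings cancel, L contributes a nonpositive term, and firm nonexpansiveness of P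
handles −y + x. The energy therefore decreases at least at the rate f(x) − f(x*) − ⟨g*, x − x*⟩
(`flow_inner_le`), whichever subgradients the inclusion selects.

The energy bounds x, λ and z, but not y. However y' = −y + b with b bounded, because subgradients
are bounded on compact subsets of U; so y is bounded, and y and x are Lipschitz in time. By strict
convexity the decay rate has a positive lower bound on bounded parts of Ω away from x*. If x were
far from x* at a late time, it would stay far for a fixed duration and the energy would fall by a
fixed amount, which is impossible once the energy is close to its infimum. -/

/-! ### Absolutely continuous curves and differential inequalities -/

/-- A function whose increments are dominated by those of an absolutely continuous function is
absolutely continuous. -/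
theorem AbsolutelyContinuousOnInterval.of_dist_le {X Y : Type*} [PseudoMetricSpace X]
    [PseudoMetricSpace Y] {f : ℝ → X} {h : ℝ → Y} {a b K : ℝ}
    (hf : AbsolutelyContinuousOnInterval f a b)
    (hK : ∀ s ∈ Set.uIcc a b, ∀ t ∈ Set.uIcc a b, dist (h s) (h t) ≤ K * dist (f s) (f t)) :
    AbsolutelyContinuousOnInterval h a b := by
  have hlim : Tendsto (fun E : ℕ × (ℕ → ℝ × ℝ) =>
      K * ∑ i ∈ Finset.range E.1, dist (f (E.2 i).1) (f (E.2 i).2))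
      (totalLengthFilter ⊓ 𝓟 (disjWithin a b)) (𝓝 0) := by
    simpa using Tendsto.const_mul K hf
  refine squeeze_zero' (Eventually.of_forall fun E => Finset.sum_nonneg fun i _ => dist_nonneg)
    ?_ hlim
  filter_upwards [mem_inf_of_right (mem_principal_self (disjWithin a b))] with E hE
  rw [Finset.mul_sum]
  exact Finset.sum_le_sum fun i hi => hK _ (hE.1 i hi).1 _ (hE.1 i hi).2

/-- Composition with a map that is Lipschitz on bounded sets preserves absolute continuity. -/
theorem AbsolutelyContinuousOnInterval.comp_of_lipschitz_on_bounded {E F : Type*}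
    [SeminormedAddCommGroup E] [PseudoMetricSpace F] {f : ℝ → E} {φ : E → F} {a b : ℝ}
    (hf : AbsolutelyContinuousOnInterval f a b)
    (hφ : ∀ R : ℝ, ∃ K : ℝ, ∀ u v, ‖u‖ ≤ R → ‖v‖ ≤ R → dist (φ u) (φ v) ≤ K * dist u v) :
    AbsolutelyContinuousOnInterval (fun t => φ (f t)) a b := by
  obtain ⟨R, hR⟩ := hf.exists_bound
  obtain ⟨K, hK⟩ := hφ R
  exact hf.of_dist_le fun s hs t ht => hK _ _ (hR s hs) (hR t ht)

/-- An absolutely continuous function with nonpositive derivative almost everywhere decreases. -/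
theorem AbsolutelyContinuousOnInterval.le_of_ae_hasDerivAt_nonpos {φ : ℝ → ℝ} {a b : ℝ}
    (hab : a ≤ b) (hφ : AbsolutelyContinuousOnInterval φ a b)
    (hd : ∀ᵐ t ∂(volume.restrict (Set.Icc a b)), ∃ φ' ≤ 0, HasDerivAt φ φ' t) :
    φ b ≤ φ a := by
  have h := hφ.integral_deriv_eq_sub
  have h2 : ∫ t in a..b, deriv φ t ≤ 0 := by
    rw [intervalIntegral.integral_of_le hab]
    refine integral_nonpos_of_ae ?_
    filter_upwards [ae_restrict_of_ae_restrict_of_subset Set.Ioc_subset_Icc_self hd] with t ht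
    obtain ⟨φ', h0, hφ'⟩ := ht
    simpa [hφ'.deriv] using h0
  linarith

/-- An absolutely continuous curve whose speed is almost everywhere at most `M` is
`M`-Lipschitz. -/
theorem AbsolutelyContinuousOnInterval.norm_sub_le_of_ae_hasDerivAt {E : Type*}
    [NormedAddCommGroup E] [InnerProductSpace ℝ E] {f : ℝ → E} {a b M : ℝ}
    (hab : a ≤ b) (hf : AbsolutelyContinuousOnInterval f a b)
    (hd : ∀ᵐ t ∂(volume.restrict (Set.Icc a b)), ∃ f', ‖f'‖ ≤ M ∧ HasDerivAt f f' t) :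
    ‖f b - f a‖ ≤ M * (b - a) := by
  set v := f b - f a with hv
  -- The main argument tests `f` against the direction `v` and divides by `‖v‖`. When `v = 0` the
  -- claim needs `0 ≤ M` if `a < b`, which is read off at any one of the almost every admissible
  -- times.
  rcases eq_or_ne v 0 with h0 | h0
  · rcases hab.eq_or_lt with rfl | hlt
    · simp [hv]
    · rw [h0, norm_zero]
      have : (ae (volume.restrict (Set.Icc a b))).NeBot := by
        rw [ae_neBot]
        intro h
        have := congrArg (fun μ => μ Set.univ) h
        simp only [Measure.restrict_apply_univ, Real.volume_Icc, Measure.coe_zero,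
          Pi.zero_apply, ENNReal.ofReal_eq_zero] at this
        linarith
      obtain ⟨t, f', hf', -⟩ := hd.exists
      exact mul_nonneg ((norm_nonneg _).trans hf') (by linarith)
  have hinner : AbsolutelyContinuousOnInterval (fun t => ⟪v, f t⟫) a b := by
    refine hf.of_dist_le (K := ‖v‖) fun s _ t _ => ?_
    rw [Real.dist_eq, ← inner_sub_right, dist_eq_norm]
    exact abs_real_inner_le_norm _ _
  have hlin : AbsolutelyContinuousOnInterval (fun t : ℝ => ‖v‖ * M * t) a b :=
    ContDiffOn.absolutelyContinuousOnInterval (by fun_prop)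
  have key := (hinner.fun_sub hlin).le_of_ae_hasDerivAt_nonpos hab (by
    filter_upwards [hd] with t ht
    obtain ⟨f', hf', hft⟩ := ht
    refine ⟨⟪v, f'⟫ - ‖v‖ * M * 1, ?_, ?_⟩
    · have h1 := real_inner_le_norm v f'
      have h2 := mul_le_mul_of_nonneg_left hf' (norm_nonneg v)
      linarith
    · have h1 : HasDerivAt (fun t => ⟪v, f t⟫) ⟪v, f'⟫ t := by
        simpa using (hasDerivAt_const t v).inner ℝ hft
      exact h1.sub ((hasDerivAt_id t).const_mul _))
  have h3 : ‖v‖ * ‖v‖ ≤ ‖v‖ * (M * (b - a)) := by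
    have : ‖v‖ * ‖v‖ = ⟪v, f b⟫ - ⟪v, f a⟫ := by
      rw [← inner_sub_right, ← hv, real_inner_self_eq_norm_mul_norm]
    rw [this]
    linarith
  exact le_of_mul_le_mul_left h3 (norm_pos_iff.2 h0)

/-- A curve with `f' = -f + b` and `b` bounded is bounded. -/
theorem norm_le_of_ae_hasDerivAt_neg_add {E : Type*} [NormedAddCommGroup E]
    [InnerProductSpace ℝ E] {f : ℝ → E} {C T : ℝ} (hT : 0 ≤ T)
    (hf : AbsolutelyContinuousOnInterval f 0 T)
    (hd : ∀ᵐ t ∂(volume.restrict (Set.Icc 0 T)), ∃ b, ‖b‖ ≤ C ∧ HasDerivAt f (-(f t) + b) t) :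
    ‖f T‖ ^ 2 ≤ ‖f 0‖ ^ 2 + C ^ 2 := by
  have hsq : AbsolutelyContinuousOnInterval (fun t => ‖f t‖ ^ 2) 0 T := by
    refine hf.comp_of_lipschitz_on_bounded (φ := fun u => ‖u‖ ^ 2) fun R => ⟨2 * R, ?_⟩
    intro u v hu hv
    rw [Real.dist_eq, dist_eq_norm, sq_sub_sq, abs_mul]
    refine mul_le_mul ?_ (abs_norm_sub_norm_le u v) (abs_nonneg _) ?_
    · rw [abs_of_nonneg (by positivity)]; linarith
    · linarith [norm_nonneg u]
  have hexp : AbsolutelyContinuousOnInterval (fun t : ℝ => Real.exp t) 0 T :=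
    ContDiffOn.absolutelyContinuousOnInterval (by fun_prop)
  have hconst : AbsolutelyContinuousOnInterval (fun _ : ℝ => C ^ 2) 0 T :=
    ContDiffOn.absolutelyContinuousOnInterval (by fun_prop)
  -- The integrating factor: exp(t)(‖f‖² − C²) is nonincreasing, its derivative being at most
  -- −exp(t)(‖f‖ − C)².
  have key := (hexp.fun_mul (hsq.fun_sub hconst)).le_of_ae_hasDerivAt_nonpos hT (by
    filter_upwards [hd] with t ht
    obtain ⟨b, hb, hft⟩ := ht
    refine ⟨Real.exp t * (‖f t‖ ^ 2 - C ^ 2) + Real.exp t * (2 * ⟪f t, -(f t) + b⟫), ?_, ?_⟩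
    · rw [← mul_add]
      refine mul_nonpos_of_nonneg_of_nonpos (Real.exp_pos t).le ?_
      rw [inner_add_right, inner_neg_right, real_inner_self_eq_norm_sq]
      have h1 := real_inner_le_norm (f t) b
      have h2 := mul_le_mul_of_nonneg_left hb (norm_nonneg (f t))
      nlinarith [sq_nonneg (‖f t‖ - C)]
    · exact (Real.hasDerivAt_exp t).mul (hft.norm_sq.sub_const _))
  rw [Real.exp_zero, one_mul] at key
  have h1 : 1 ≤ Real.exp T := Real.one_le_exp hT
  by_cases hc : ‖f T‖ ^ 2 - C ^ 2 ≤ 0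
  · nlinarith [sq_nonneg ‖f 0‖]
  · nlinarith [sq_nonneg C]

/-! ### Projections and their energy -/

/-- `proj` satisfies the variational characterization of the projection onto `Ω`. -/
structure IsProjectionMap {E : Type*} [NormedAddCommGroup E] [InnerProductSpace ℝ E]
    (Ω : Set E) (proj : E → E) : Prop where
  mem : ∀ u, proj u ∈ Ω
  inner_nonpos : ∀ u, ∀ w ∈ Ω, ⟪u - proj u, w - proj u⟫ ≤ 0

/-- Half the difference of the squared distances from `u` to `c` and to `proj u`. -/
noncomputable def projEnergy {E : Type*} [NormedAddCommGroup E] (proj : E → E) (c u : E) : ℝ :=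
  (‖u - c‖ ^ 2 - ‖u - proj u‖ ^ 2) / 2

namespace IsProjectionMap

variable {E : Type*} [NormedAddCommGroup E] [InnerProductSpace ℝ E] {Ω : Set E} {proj : E → E}

/-- With the identity as projection, `projEnergy` is half the squared distance, so the multiplier
components need no separate treatment. -/
theorem of_univ : IsProjectionMap (Set.univ : Set E) (fun u => u) :=
  ⟨fun _ => Set.mem_univ _, fun u w _ => by simp⟩

/-- Firm nonexpansiveness: add the variational inequalities at `u` and `v`, each tested at the
other's projection. -/
theorem norm_sq_le_inner (h : IsProjectionMap Ω proj) (u v : E) :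
    ‖proj u - proj v‖ ^ 2 ≤ ⟪u - v, proj u - proj v⟫ := by
  have h1 := h.inner_nonpos u _ (h.mem v)
  have h2 := h.inner_nonpos v _ (h.mem u)
  rw [← real_inner_self_eq_norm_sq]
  simp only [inner_sub_left, inner_sub_right] at *
  linarith

theorem norm_sub_le (h : IsProjectionMap Ω proj) (u v : E) :
    ‖proj u - proj v‖ ≤ ‖u - v‖ := by
  have h1 := h.norm_sq_le_inner u v
  have h2 := real_inner_le_norm (u - v) (proj u - proj v)
  by_contra! hc
  nlinarith [norm_nonneg (u - v)]

theorem eq_of_inner_nonpos (h : IsProjectionMap Ω proj) {u c : E} (hc : c ∈ Ω)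
    (hu : ∀ w ∈ Ω, ⟪u - c, w - c⟫ ≤ 0) : proj u = c := by
  have h1 := h.inner_nonpos u c hc
  have h2 := hu _ (h.mem u)
  have h3 : ⟪proj u - c, proj u - c⟫ ≤ 0 := by
    simp only [inner_sub_left, inner_sub_right] at *
    linarith
  exact sub_eq_zero.1 (inner_self_eq_zero.1 (le_antisymm h3 real_inner_self_nonneg))

theorem norm_sq_le_projEnergy (h : IsProjectionMap Ω proj) {c : E} (hc : c ∈ Ω) (u : E) :
    ‖proj u - c‖ ^ 2 / 2 ≤ projEnergy proj c u := by
  have h1 := h.inner_nonpos u c hc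
  have h2 : u - c = (u - proj u) - (c - proj u) := by abel
  rw [projEnergy, h2, norm_sub_sq_real (u - proj u) (c - proj u), norm_sub_rev (proj u) c]
  linarith

/-- Replacing `proj v` by the farther point `proj u` of `Ω` can only lower the energy at `v`, and
then the difference is exactly linear in `v - u`. This is the subgradient inequality for a convex
energy. -/
theorem inner_le_projEnergy_sub (h : IsProjectionMap Ω proj) (c u v : E) :
    ⟪proj u - c, v - u⟫ ≤ projEnergy proj c v - projEnergy proj c u := by
  have h1 := h.inner_nonpos v _ (h.mem u)
  have h2 := norm_sub_sq_real (v - proj v) (proj u - proj v)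
  have h3 := norm_add_sq_real (v - u) (u - c)
  have h4 := norm_add_sq_real (v - u) (u - proj u)
  have h5 : ⟪proj u - c, v - u⟫ = ⟪v - u, u - c⟫ - ⟪v - u, u - proj u⟫ := by
    rw [← inner_sub_right, real_inner_comm, sub_sub_sub_cancel_left]
  rw [sub_sub_sub_cancel_right] at h2
  rw [sub_add_sub_cancel] at h3 h4
  rw [projEnergy, projEnergy]
  nlinarith [sq_nonneg ‖proj u - proj v‖]

/-- The subgradient inequality used in both directions, together with nonexpansiveness, leaves a
quadratic remainder; differentiability follows without differentiating `proj`. -/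
theorem abs_projEnergy_sub_le (h : IsProjectionMap Ω proj) (c u v : E) :
    |projEnergy proj c v - projEnergy proj c u - ⟪proj u - c, v - u⟫| ≤ ‖v - u‖ ^ 2 := by
  have h1 := h.inner_le_projEnergy_sub c u v
  have h2 := h.inner_le_projEnergy_sub c v u
  have h3 : ⟪proj v - proj u, v - u⟫ ≤ ‖v - u‖ ^ 2 := by
    have := real_inner_le_norm (proj v - proj u) (v - u)
    have := mul_le_mul_of_nonneg_right (h.norm_sub_le v u) (norm_nonneg (v - u))
    nlinarith
  have h4 : ⟪proj v - proj u, v - u⟫ = -⟪proj v - c, u - v⟫ - ⟪proj u - c, v - u⟫ := by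
    simp only [inner_sub_left, inner_sub_right]
    ring
  rw [abs_le]
  constructor <;> nlinarith [sq_nonneg ‖v - u‖]

theorem hasFDerivAt_projEnergy (h : IsProjectionMap Ω proj) (c u : E) :
    HasFDerivAt (projEnergy proj c) (innerSL ℝ (proj u - c)) u := by
  rw [hasFDerivAt_iff_isLittleO]
  have h1 : (fun v => projEnergy proj c v - projEnergy proj c u - innerSL ℝ (proj u - c) (v - u))
      =O[𝓝 u] fun v => ‖v - u‖ ^ 2 := by
    refine Asymptotics.IsBigO.of_bound 1 (Eventually.of_forall fun v => ?_)
    rw [one_mul, Real.norm_eq_abs, norm_pow, norm_norm, innerSL_apply_apply]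
    exact h.abs_projEnergy_sub_le c u v
  refine h1.trans_isLittleO ?_
  have h2 : Tendsto (fun v : E => ‖v - u‖) (𝓝 u) (𝓝 0) := by
    simpa using ((continuous_id.sub continuous_const).norm (E := E)).tendsto' u ‖u - u‖ rfl
  rw [← Asymptotics.isLittleO_norm_right]
  simp only [sq]
  simpa using (Asymptotics.isLittleO_one_iff ℝ |>.2 h2).mul_isBigO
    (Asymptotics.isBigO_refl (fun v : E => ‖v - u‖) (𝓝 u))

theorem hasDerivAt_projEnergy (h : IsProjectionMap Ω proj) (c : E) {y : ℝ → E} {y' : E} {t : ℝ}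
    (hy : HasDerivAt y y' t) :
    HasDerivAt (fun s => projEnergy proj c (y s)) ⟪proj (y t) - c, y'⟫ t := by
  exact (h.hasFDerivAt_projEnergy c (y t)).comp_hasDerivAt t hy

theorem absolutelyContinuousOnInterval_projEnergy (h : IsProjectionMap Ω proj) (c : E)
    {y : ℝ → E} {a b : ℝ} (hy : AbsolutelyContinuousOnInterval y a b) :
    AbsolutelyContinuousOnInterval (fun t => projEnergy proj c (y t)) a b := by
  refine hy.comp_of_lipschitz_on_bounded fun R => ⟨(R + ‖proj 0 - c‖) + 2 * R, ?_⟩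
  intro v u hv hu
  rw [Real.dist_eq, dist_eq_norm]
  have h1 := h.abs_projEnergy_sub_le c u v
  have h2 : |⟪proj u - c, v - u⟫| ≤ (R + ‖proj 0 - c‖) * ‖v - u‖ := by
    refine (abs_real_inner_le_norm _ _).trans
      (mul_le_mul_of_nonneg_right ?_ (norm_nonneg _))
    have h3 := norm_add_le (proj u - proj 0) (proj 0 - c)
    have h4 := h.norm_sub_le u 0
    rw [sub_add_sub_cancel] at h3
    rw [sub_zero] at h4
    linarith
  have h5 : ‖v - u‖ ^ 2 ≤ 2 * R * ‖v - u‖ := by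
    rw [sq]
    refine mul_le_mul_of_nonneg_right ?_ (norm_nonneg _)
    linarith [_root_.norm_sub_le v u]
  have h6 := abs_sub_abs_le_abs_sub (projEnergy proj c v - projEnergy proj c u)
    ⟪proj u - c, v - u⟫
  nlinarith

end IsProjectionMap

/-! ### Subgradients and the KKT conditions -/

section Convex

variable {E : Type*} [NormedAddCommGroup E] [InnerProductSpace ℝ E]

/-- `g` is a subgradient at `x` of the function `F` with domain `U`. -/
def IsSubgradientOn (U : Set E) (F : E → ℝ) (x g : E) : Prop :=
  ∀ v ∈ U, ⟪g, v - x⟫ ≤ F v - F x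

/-- The excess of `F` over its affine minorant at `c` with slope `g`. -/
noncomputable def subgradientGap (F : E → ℝ) (c g x : E) : ℝ := F x - F c - ⟪g, x - c⟫

/-- At the midpoint of `x` and `c`, strict convexity bounds `F` above and the subgradient bounds it
below. -/
theorem subgradientGap_pos {U : Set E} {F : E → ℝ} (hF : StrictConvexOn ℝ U F) {c g x : E}
    (hc : c ∈ U) (hg : IsSubgradientOn U F c g) (hx : x ∈ U) (hne : x ≠ c) :
    0 < subgradientGap F c g x := by
  have h0 : (0 : ℝ) < 1 / 2 := by norm_num
  have h1 := hF.2 hx hc hne h0 h0 (by norm_num)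
  have h2 := hg _ (hF.1 hx hc h0.le h0.le (by norm_num))
  have h3 : (1 / 2 : ℝ) • x + (1 / 2 : ℝ) • c - c = (1 / 2 : ℝ) • (x - c) := by module
  rw [h3, inner_smul_right] at h2
  simp only [smul_eq_mul] at h1
  rw [subgradientGap]
  linarith

theorem subgradientGap_nonneg {U : Set E} {F : E → ℝ} {c g x : E}
    (hg : IsSubgradientOn U F c g) (hx : x ∈ U) : 0 ≤ subgradientGap F c g x := by
  have := hg x hx
  rw [subgradientGap]
  linarith

/-- Subgradients of a continuous function are bounded on compact subsets of its open domain. -/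
theorem exists_norm_le_of_isSubgradientOn [FiniteDimensional ℝ E] {U K : Set E} {F : E → ℝ}
    (hU : IsOpen U) (hF : ContinuousOn F U) (hK : IsCompact K) (hKU : K ⊆ U) :
    ∃ C : ℝ, ∀ x ∈ K, ∀ g, IsSubgradientOn U F x g → ‖g‖ ≤ C := by
  obtain ⟨δ, hδ, hsub⟩ := hK.exists_cthickening_subset_open hU hKU
  have hcomp : IsCompact (Metric.cthickening δ K) := hK.cthickening
  obtain ⟨B, hB⟩ := hcomp.exists_bound_of_continuousOn (hF.mono hsub)
  refine ⟨2 * B / δ, fun x hx g hg => ?_⟩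
  have hB0 : ‖F x‖ ≤ B := hB x (Metric.self_subset_cthickening K hx)
  rcases eq_or_ne g 0 with rfl | hg0
  · rw [norm_zero]
    have := (norm_nonneg _).trans hB0
    positivity
  have hn : 0 < ‖g‖ := norm_pos_iff.2 hg0
  -- A move of length `δ` along `g` raises `F` by at least `δ * ‖g‖`, while `F` varies by at most `2
  -- * B` on the thickening.
  set v := x + (δ / ‖g‖) • g with hv
  have hvK : v ∈ Metric.cthickening δ K := by
    refine Metric.mem_cthickening_of_dist_le v x δ K hx ?_
    rw [dist_eq_norm, hv, add_sub_cancel_left, norm_smul, Real.norm_of_nonneg (by positivity),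
      div_mul_cancel₀ _ hn.ne']
  have h1 := hg v (hsub hvK)
  rw [hv, add_sub_cancel_left, inner_smul_right, real_inner_self_eq_norm_mul_norm, ← hv,
    ← mul_assoc, div_mul_cancel₀ _ hn.ne'] at h1
  have h2 := hB v hvK
  rw [Real.norm_eq_abs, abs_le] at h2 hB0
  rw [le_div_iff₀ hδ]
  linarith

omit [InnerProductSpace ℝ E] in
theorem isOpen_strict_epigraph {U : Set E} {F : E → ℝ} (hU : IsOpen U) (hF : ContinuousOn F U) :
    IsOpen {p : E × ℝ | p.1 ∈ U ∧ F p.1 < p.2} := by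
  have h : IsOpen (U ×ˢ (Set.univ : Set ℝ)) := hU.prod isOpen_univ
  have h2 : ContinuousOn (fun p : E × ℝ => p.2 - F p.1) (U ×ˢ (Set.univ : Set ℝ)) :=
    continuousOn_snd.sub (hF.comp continuousOn_fst fun p hp => hp.1)
  convert h2.isOpen_inter_preimage h (isOpen_Ioi (a := (0 : ℝ))) using 1
  ext p
  simp

variable [FiniteDimensional ℝ E]

/-- Separation of the strict epigraph of `F` over an open set `U` from `S × (-∞, F c]`, where `c`
minimizes `F` over `U ∩ S`: the separating functional gives a slope `g`. -/
theorem exists_slope_of_isMinOn {U S : Set E} {F : E → ℝ} {c : E} (hU : IsOpen U)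
    (hF : ConvexOn ℝ U F) (hS : Convex ℝ S) (hne : (U ∩ S).Nonempty)
    (hmin : ∀ x ∈ U ∩ S, F c ≤ F x) :
    ∃ g : E, (∀ x ∈ U, ∀ w ∈ S, ⟪g, x - w⟫ ≤ F x - F c) := by
  have hdisj : Disjoint {p : E × ℝ | p.1 ∈ U ∧ F p.1 < p.2} (S ×ˢ Set.Iic (F c)) := by
    rw [Set.disjoint_left]
    rintro ⟨x, r⟩ ⟨h1, h2⟩ ⟨h3, h4⟩
    exact absurd (hmin x ⟨h1, h3⟩) (not_le.2 (h2.trans_le h4))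
  obtain ⟨φ, u, h1, h2⟩ := geometric_hahn_banach_open hF.convex_strict_epigraph
    (isOpen_strict_epigraph hU (hF.continuousOn hU)) (hS.prod (convex_Iic _)) hdisj
  set τ : ℝ := φ (0, 1) with hτ
  have hφ : ∀ x r, φ (x, r) = φ (x, 0) + r * τ := by
    intro x r
    have : ((x, r) : E × ℝ) = (x, 0) + r • (0, 1) := by simp
    rw [this, map_add, map_smul, smul_eq_mul]
  obtain ⟨p, hp⟩ : ∃ p : E, ∀ x, φ (x, 0) = ⟪p, x⟫ := by
    refine ⟨(InnerProductSpace.toDual ℝ E).symm (φ.comp (ContinuousLinearMap.inl ℝ E ℝ)),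
      fun x => ?_⟩
    rw [InnerProductSpace.toDual_symm_apply]
    simp
  have key : ∀ x ∈ U, ∀ w ∈ S, ∀ r, F x < r → ∀ s ≤ F c, ⟪p, x⟫ + r * τ < ⟪p, w⟫ + s * τ := by
    intro x hx w hw r hr s hs
    have h3 := h1 (x, r) ⟨hx, hr⟩
    have h4 := h2 (w, s) ⟨hw, hs⟩
    rw [hφ, hp] at h3 h4
    linarith
  -- Comparing two heights over a common point of `U` and `S` excludes a vertical hyperplane.
  have hτ0 : τ < 0 := by
    obtain ⟨x, hxU, hxS⟩ := hne
    have h3 := key x hxU x hxS (F x + 1) (by linarith) (F c) le_rfl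
    have h4 := hmin x ⟨hxU, hxS⟩
    by_contra! h5
    nlinarith
  refine ⟨(-τ)⁻¹ • p, fun x hx w hw => ?_⟩
  have h3 : ∀ ε > 0, ⟪p, x - w⟫ ≤ (F x - F c) * -τ + ε := by
    intro ε hε
    have h4 := key x hx w hw (F x + ε / -τ) (by linarith [div_pos hε (neg_pos.2 hτ0)])
      (F c) le_rfl
    have h5 : ε / -τ * τ = -ε := by
      rw [div_neg, neg_mul, div_mul_cancel₀ _ hτ0.ne]
    rw [inner_sub_right]
    nlinarith
  have h4 : ⟪p, x - w⟫ ≤ (F x - F c) * -τ := le_of_forall_pos_le_add h3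
  rw [real_inner_smul_left, inv_mul_le_iff₀ (neg_pos.2 hτ0)]
  linarith

/-- Karush–Kuhn–Tucker conditions for a convex program with affine equality constraints under
Slater's condition. -/
theorem exists_multiplier_of_isMinOn {M : Type*} [NormedAddCommGroup M] [InnerProductSpace ℝ M]
    [FiniteDimensional ℝ M] {U Ω : Set E} {F : E → ℝ} {W : E →ₗ[ℝ] M} {b : M} {c s : E}
    (hU : IsOpen U) (hF : ConvexOn ℝ U F) (hΩU : Ω ⊆ U) (hΩ : Convex ℝ Ω)
    (hcΩ : c ∈ Ω) (hcb : W c = b) (hmin : ∀ x ∈ Ω, W x = b → F c ≤ F x)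
    (hs : s ∈ interior Ω) (hsb : W s = b) :
    ∃ g μ, IsSubgradientOn U F c g ∧ ∀ w ∈ Ω, 0 ≤ ⟪g - W.adjoint μ, w - c⟫ := by
  have haff : Convex ℝ {x : E | W x = b} := (convex_singleton b).linear_preimage W
  -- Fixing `w = c` makes `g` a subgradient; fixing `x = c` makes `c` a minimizer of `⟪g, ·⟫` on the
  -- feasible set. A second separation then splits this linear problem between `Ω` and the affine
  -- constraint.
  obtain ⟨g, hg⟩ := exists_slope_of_isMinOn (S := Ω ∩ {x | W x = b}) (c := c) hU hF
    (hΩ.inter haff) ⟨c, hΩU hcΩ, hcΩ, hcb⟩ fun x hx => hmin x hx.2.1 hx.2.2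
  have hgs : IsSubgradientOn U F c g := fun v hv => hg v hv c ⟨hcΩ, hcb⟩
  have hgn : ∀ w ∈ Ω, W w = b → ⟪g, c⟫ ≤ ⟪g, w⟫ := by
    intro w hw hwb
    have := hg c (hΩU hcΩ) w ⟨hw, hwb⟩
    rw [inner_sub_right] at this
    linarith
  have hlin : ConvexOn ℝ (interior Ω) fun x => ⟪g, x⟫ :=
    ((innerSL ℝ g).toLinearMap.convexOn hΩ.interior)
  obtain ⟨p, hp⟩ := exists_slope_of_isMinOn (S := {x | W x = b}) (c := c) isOpen_interior hlin
    haff ⟨s, hs, hsb⟩ fun x hx => hgn x (interior_subset hx.1) hx.2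
  -- The bound at the Slater point holds along whole lines in the kernel, and a linear function
  -- bounded above on a line is constant.
  have hpk : p ∈ W.kerᗮ := by
    rw [Submodule.mem_orthogonal']
    intro v hv
    have hle : ∀ r : ℝ, r * ⟪p, v⟫ ≤ ⟪g, s⟫ - ⟪g, c⟫ := by
      intro r
      have hv' : W v = 0 := hv
      have h1 := hp s hs (s - r • v) (by simp [hv', hsb])
      rwa [sub_sub_cancel, inner_smul_right] at h1
    by_contra hne
    have h1 := hle ((⟪g, s⟫ - ⟪g, c⟫ + 1) / ⟪p, v⟫)
    rw [div_mul_cancel₀ _ hne] at h1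
    linarith
  rw [LinearMap.orthogonal_ker] at hpk
  obtain ⟨μ, hμ⟩ := hpk
  refine ⟨g, μ, hgs, ?_⟩
  rw [hμ]
  have hcl : Ω ⊆ closure (interior Ω) := by
    rw [hΩ.closure_interior_eq_closure_of_nonempty_interior ⟨s, hs⟩]
    exact subset_closure
  have hclosed : IsClosed {w : E | 0 ≤ ⟪g - p, w - c⟫} :=
    isClosed_le continuous_const (by fun_prop)
  refine fun w hw => closure_minimal (fun w hw => ?_) hclosed (hcl hw)
  have h1 := hp w hw c hcb
  simp only [Set.mem_ofPred_eq, inner_sub_left, inner_sub_right] at *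
  linarith

end Convex

/-! ### Energy dissipation and convergence of the projected flow -/

section Flow

variable {E G : Type*} [NormedAddCommGroup E] [InnerProductSpace ℝ E]
  [NormedAddCommGroup G] [InnerProductSpace ℝ G]

/-- Projected primal-dual flow with state `(y, lam, z)` and output `x = proj y`. -/
structure IsProjectedFlow (U : Set E) (F : E → ℝ) (proj : E → E) (A : E →ₗ[ℝ] G) (B : G →ₗ[ℝ] E)
    (L : G →ₗ[ℝ] G) (d : G) (y x : ℝ → E) (lam z : ℝ → G) : Prop where
  ac_y : ∀ T : ℝ, 0 < T → AbsolutelyContinuousOnInterval y 0 T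
  ac_lam : ∀ T : ℝ, 0 < T → AbsolutelyContinuousOnInterval lam 0 T
  ac_z : ∀ T : ℝ, 0 < T → AbsolutelyContinuousOnInterval z 0 T
  output : ∀ t : ℝ, 0 ≤ t → x t = proj (y t)
  deriv_y : ∀ᵐ t ∂(volume.restrict (Set.Ici (0 : ℝ))), ∃ g, IsSubgradientOn U F (x t) g ∧
    HasDerivAt y (-(y t) + x t - g + B (lam t)) t
  deriv_lam : ∀ᵐ t ∂(volume.restrict (Set.Ici (0 : ℝ))),
    HasDerivAt lam (d - A (x t) - L (lam t) - L (z t)) t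
  deriv_z : ∀ᵐ t ∂(volume.restrict (Set.Ici (0 : ℝ))), HasDerivAt z (L (lam t)) t

/-- Equilibrium of the projected primal-dual flow, with output `c` and subgradient `g`. -/
structure IsFlowEquilibrium (U : Set E) (F : E → ℝ) (proj : E → E) (A : E →ₗ[ℝ] G)
    (B : G →ₗ[ℝ] E) (L : G →ₗ[ℝ] G) (d : G) (c g : E) (ls zs : G) : Prop where
  isSubgradientOn : IsSubgradientOn U F c g
  proj_eq : proj (c - g + B ls) = c
  map_ls : L ls = 0
  map_zs : A c + L zs = d

/-- Lyapunov function of the projected primal-dual flow. -/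
noncomputable def flowEnergy (proj : E → E) (c : E) (ls zs : G) (y : E) (lam z : G) : ℝ :=
  projEnergy proj c y + projEnergy (fun u => u) ls lam + projEnergy (fun u => u) zs z

theorem AbsolutelyContinuousOnInterval.mono_of_nonneg {X : Type*} [PseudoMetricSpace X]
    {f : ℝ → X} (hf : ∀ T : ℝ, 0 < T → AbsolutelyContinuousOnInterval f 0 T) {a b : ℝ}
    (ha : 0 ≤ a) (hab : a ≤ b) : AbsolutelyContinuousOnInterval f a b := by
  refine (hf (b + 1) (by linarith)).mono ?_
  rw [Set.uIcc_of_le hab, Set.uIcc_of_le (by linarith)]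
  exact Set.Icc_subset_Icc ha (by linarith)

theorem ae_restrict_Icc_of_Ici {p : ℝ → Prop} {a b : ℝ} (ha : 0 ≤ a)
    (h : ∀ᵐ t ∂(volume.restrict (Set.Ici (0 : ℝ))), p t) :
    ∀ᵐ t ∂(volume.restrict (Set.Icc a b)), p t ∧ t ∈ Set.Icc a b := by
  filter_upwards [ae_restrict_of_ae_restrict_of_subset (fun t ht => ha.trans ht.1) h,
    ae_restrict_mem measurableSet_Icc] with t h1 h2
  exact ⟨h1, h2⟩

theorem norm_le_of_norm_sub_sq_le {H : Type*} [SeminormedAddCommGroup H] {u v : H} {V : ℝ}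
    (h : ‖u - v‖ ^ 2 / 2 ≤ V) : ‖u‖ ≤ ‖v‖ + (V + 1) := by
  have h1 := norm_add_le (u - v) v
  rw [sub_add_cancel] at h1
  nlinarith [sq_nonneg (‖u - v‖ - 1)]

variable {Ω U : Set E} {F : E → ℝ} {proj : E → E} {A : E →ₗ[ℝ] G} {B : G →ₗ[ℝ] E}
  {L : G →ₗ[ℝ] G} {d : G} {c gs : E} {ls zs : G} {y x : ℝ → E} {lam z : ℝ → G}

/-- Subtract the equilibrium equations. The `A`/`B` and `lam`/`z` couplings are skew and cancel,
firm nonexpansiveness absorbs the projection terms, and positivity of `L` discards the damping. What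
remains is `⟪proj v - c, gs - g⟫`, which the subgradient inequality for `g` tested at `c` bounds by
minus the gap. -/
theorem flow_inner_le (hproj : IsProjectionMap Ω proj) (hΩU : Ω ⊆ U)
    (hAB : ∀ u μ, ⟪A u, μ⟫ = ⟪u, B μ⟫) (hL : L.IsSymmetric) (hLpos : ∀ μ, 0 ≤ ⟪L μ, μ⟫)
    (heq : IsFlowEquilibrium U F proj A B L d c gs ls zs) {v g : E} {l w : G}
    (hg : IsSubgradientOn U F (proj v) g) :
    ⟪proj v - c, -v + proj v - g + B l⟫ + ⟪l - ls, d - A (proj v) - L l - L w⟫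
      + ⟪w - zs, L l⟫ ≤ -subgradientGap F c gs (proj v) := by
  have hcΩ : c ∈ Ω := heq.proj_eq ▸ hproj.mem _
  have h1 := hproj.norm_sq_le_inner v (c - gs + B ls)
  rw [heq.proj_eq, ← real_inner_self_eq_norm_sq] at h1
  have h2 := hg c (hΩU hcΩ)
  have h3 : ⟪A (proj v - c), l - ls⟫ = ⟪proj v - c, B (l - ls)⟫ := hAB _ _
  have h4 := hLpos (l - ls)
  have h5 : ⟪L (l - ls), w - zs⟫ = ⟪l - ls, L (w - zs)⟫ := hL _ _
  have h6 := heq.map_ls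
  rw [← heq.map_zs, subgradientGap]
  set e := proj v - c with he
  have h7 : proj v = e + c := by rw [he]; abel
  have h8 : c - proj v = -e := by rw [he]; abel
  have h9 : A c + L zs - A (proj v) - L l - L w = -A e - L (l - ls) - L (w - zs) := by
    rw [h7]
    simp only [map_sub, map_add, h6]
    abel
  have h10 : -v + proj v - g + B l = -(v - (c - gs + B ls)) + e + (gs - g) + B (l - ls) := by
    rw [h7, map_sub]
    abel
  have h11 : L l = L (l - ls) := by rw [map_sub, h6, sub_zero]
  rw [h8, inner_neg_right] at h2
  rw [h9, h10, h11]
  clear h10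
  generalize v - (c - gs + B ls) = r at h1 ⊢
  simp only [inner_add_right, inner_sub_right, inner_neg_right]
  have e1 := real_inner_comm e g
  have e2 := real_inner_comm e gs
  have e3 := real_inner_comm e r
  have e4 := real_inner_comm (l - ls) (A e)
  have e5 := real_inner_comm (l - ls) (L (l - ls))
  have e6 := real_inner_comm (w - zs) (L (l - ls))
  linarith

theorem flowEnergy_add_le (hproj : IsProjectionMap Ω proj) (hΩU : Ω ⊆ U)
    (hAB : ∀ u μ, ⟪A u, μ⟫ = ⟪u, B μ⟫) (hL : L.IsSymmetric) (hLpos : ∀ μ, 0 ≤ ⟪L μ, μ⟫)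
    (heq : IsFlowEquilibrium U F proj A B L d c gs ls zs)
    (hsol : IsProjectedFlow U F proj A B L d y x lam z) {a b κ : ℝ} (ha : 0 ≤ a) (hab : a ≤ b)
    (hκ : ∀ t ∈ Set.Icc a b, κ ≤ subgradientGap F c gs (x t)) :
    flowEnergy proj c ls zs (y b) (lam b) (z b) + κ * (b - a) ≤
      flowEnergy proj c ls zs (y a) (lam a) (z a) := by
  have hid : IsProjectionMap (Set.univ : Set G) (fun u => u) := .of_univ
  have a1 := hproj.absolutelyContinuousOnInterval_projEnergy c
    (AbsolutelyContinuousOnInterval.mono_of_nonneg hsol.ac_y ha hab)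
  have a2 := hid.absolutelyContinuousOnInterval_projEnergy ls
    (AbsolutelyContinuousOnInterval.mono_of_nonneg hsol.ac_lam ha hab)
  have a3 := hid.absolutelyContinuousOnInterval_projEnergy zs
    (AbsolutelyContinuousOnInterval.mono_of_nonneg hsol.ac_z ha hab)
  have a4 : AbsolutelyContinuousOnInterval (fun t : ℝ => κ * t) a b :=
    ContDiffOn.absolutelyContinuousOnInterval (by fun_prop)
  have key := (((a1.fun_add a2).fun_add a3).fun_add a4).le_of_ae_hasDerivAt_nonpos hab (by
    filter_upwards [ae_restrict_Icc_of_Ici ha hsol.deriv_y,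
      ae_restrict_Icc_of_Ici ha hsol.deriv_lam, ae_restrict_Icc_of_Ici ha hsol.deriv_z]
      with t h1 h2 h3
    obtain ⟨⟨g, hg, hy⟩, ht⟩ := h1
    have hx := hsol.output t (ha.trans ht.1)
    refine ⟨_, ?_, (((hproj.hasDerivAt_projEnergy c hy).add
      (hid.hasDerivAt_projEnergy ls h2.1)).add (hid.hasDerivAt_projEnergy zs h3.1)).add
      ((hasDerivAt_id t).const_mul κ)⟩
    have h4 := hκ t ht
    rw [hx] at hg h4 ⊢
    have h5 := flow_inner_le hproj hΩU hAB hL hLpos heq (l := lam t) (w := z t) hg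
    linarith)
  simp only [flowEnergy]
  linarith

section Bounds

variable (hproj : IsProjectionMap Ω proj) (hΩU : Ω ⊆ U)
  (hAB : ∀ u μ, ⟪A u, μ⟫ = ⟪u, B μ⟫) (hL : L.IsSymmetric) (hLpos : ∀ μ, 0 ≤ ⟪L μ, μ⟫)
  (heq : IsFlowEquilibrium U F proj A B L d c gs ls zs)
  (hsol : IsProjectedFlow U F proj A B L d y x lam z)

include hproj hΩU hAB hL hLpos heq hsol

theorem flowEnergy_antitoneOn :
    AntitoneOn (fun t => flowEnergy proj c ls zs (y t) (lam t) (z t)) (Set.Ici 0) := by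
  intro a ha b _ hab
  have h := flowEnergy_add_le hproj hΩU hAB hL hLpos heq hsol ha hab (κ := 0) fun t ht => by
    rw [hsol.output t (le_trans ha ht.1)]
    exact subgradientGap_nonneg heq.isSubgradientOn (hΩU (hproj.mem _))
  simpa using h

theorem IsProjectedFlow.norm_output_le : ∃ R : ℝ, ∀ t, 0 ≤ t →
    ‖x t‖ ≤ R ∧ ‖lam t‖ ≤ R ∧ ‖z t‖ ≤ R := by
  have hid : IsProjectionMap (Set.univ : Set G) (fun u => u) := .of_univ
  have hcΩ : c ∈ Ω := heq.proj_eq ▸ hproj.mem _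
  set V := flowEnergy proj c ls zs (y 0) (lam 0) (z 0) with hV
  have hVt : ∀ t, 0 ≤ t → ‖x t - c‖ ^ 2 / 2 + ‖lam t - ls‖ ^ 2 / 2 + ‖z t - zs‖ ^ 2 / 2 ≤ V := by
    intro t ht
    have h1 := flowEnergy_antitoneOn hproj hΩU hAB hL hLpos heq hsol
      (Set.mem_Ici.2 le_rfl) (Set.mem_Ici.2 ht) ht
    have h2 := hproj.norm_sq_le_projEnergy hcΩ (y t)
    have h3 := hid.norm_sq_le_projEnergy (Set.mem_univ ls) (lam t)
    have h4 := hid.norm_sq_le_projEnergy (Set.mem_univ zs) (z t)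
    rw [← hsol.output t ht] at h2
    refine le_trans ?_ h1
    simp only [flowEnergy]
    linarith
  refine ⟨‖c‖ + ‖ls‖ + ‖zs‖ + (V + 1), fun t ht => ?_⟩
  have h0 := hVt t ht
  have p1 := sq_nonneg ‖x t - c‖
  have p2 := sq_nonneg ‖lam t - ls‖
  have p3 := sq_nonneg ‖z t - zs‖
  have h1 := norm_le_of_norm_sub_sq_le (u := x t) (v := c) (V := V) (by linarith)
  have h2 := norm_le_of_norm_sub_sq_le (u := lam t) (v := ls) (V := V) (by linarith)
  have h3 := norm_le_of_norm_sub_sq_le (u := z t) (v := zs) (V := V) (by linarith)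
  have q1 := norm_nonneg c
  have q2 := norm_nonneg ls
  have q3 := norm_nonneg zs
  refine ⟨?_, ?_, ?_⟩ <;> linarith

variable [FiniteDimensional ℝ E] [FiniteDimensional ℝ G]

/-- The output stays in a bounded closed part of `Ω`, a compact subset of `U`, so every selected
subgradient obeys one bound. -/
theorem IsProjectedFlow.exists_forcing_bound (hU : IsOpen U) (hF : ConvexOn ℝ U F)
    (hΩ : IsClosed Ω) :
    ∃ C : ℝ, 0 ≤ C ∧ ∀ᵐ t ∂(volume.restrict (Set.Ici (0 : ℝ))), ∃ b, ‖b‖ ≤ C ∧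
      HasDerivAt y (-(y t) + b) t := by
  obtain ⟨R, hR⟩ := hsol.norm_output_le hproj hΩU hAB hL hLpos heq
  have hR0 : 0 ≤ R := (norm_nonneg _).trans (hR 0 le_rfl).1
  have hK : IsCompact (Metric.closedBall (0 : E) R ∩ Ω) :=
    (isCompact_closedBall _ _).inter_right hΩ
  obtain ⟨C, hC⟩ := exists_norm_le_of_isSubgradientOn hU (hF.continuousOn hU) hK
    (Set.inter_subset_right.trans hΩU)
  obtain ⟨D, hD⟩ : ∃ D : ℝ, ∀ μ, ‖B μ‖ ≤ D * ‖μ‖ :=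
    ⟨‖B.toContinuousLinearMap‖, fun μ => B.toContinuousLinearMap.le_opNorm μ⟩
  refine ⟨R + |C| + |D| * R, by positivity, ?_⟩
  filter_upwards [hsol.deriv_y, ae_restrict_mem measurableSet_Ici] with t ht h0
  obtain ⟨g, hg, hy⟩ := ht
  refine ⟨x t - g + B (lam t), ?_, ?_⟩
  · have h1 := hR t h0
    have hx : x t ∈ Ω := hsol.output t h0 ▸ hproj.mem _
    have h2 := hC (x t) ⟨by simpa using h1.1, hx⟩ g hg
    have h3 : D * ‖lam t‖ ≤ |D| * R :=
      mul_le_mul (le_abs_self D) h1.2.1 (norm_nonneg _) (abs_nonneg D)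
    have h4 := norm_add_le (x t - g) (B (lam t))
    have h5 := norm_sub_le (x t) g
    have h6 := le_abs_self C
    have h7 := hD (lam t)
    linarith [h1.1]
  · convert hy using 1
    abel

theorem IsProjectedFlow.norm_state_le (hU : IsOpen U) (hF : ConvexOn ℝ U F) (hΩ : IsClosed Ω) :
    ∃ R : ℝ, ∀ t, 0 ≤ t → ‖y t‖ ≤ R := by
  obtain ⟨C, -, hC⟩ := hsol.exists_forcing_bound hproj hΩU hAB hL hLpos heq hU hF hΩ
  refine ⟨‖y 0‖ ^ 2 + C ^ 2 + 1, fun t ht => ?_⟩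
  have h := norm_le_of_ae_hasDerivAt_neg_add ht
    (AbsolutelyContinuousOnInterval.mono_of_nonneg hsol.ac_y le_rfl ht)
    ((ae_restrict_Icc_of_Ici le_rfl hC).mono fun t ht => ht.1)
  nlinarith [sq_nonneg (‖y t‖ - 1), norm_nonneg (y t)]

theorem IsProjectedFlow.exists_lipschitz_output (hU : IsOpen U) (hF : ConvexOn ℝ U F)
    (hΩ : IsClosed Ω) :
    ∃ M : ℝ, 0 ≤ M ∧ ∀ a b, 0 ≤ a → a ≤ b → ‖x b - x a‖ ≤ M * (b - a) := by
  obtain ⟨C, hC0, hC⟩ := hsol.exists_forcing_bound hproj hΩU hAB hL hLpos heq hU hF hΩ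
  obtain ⟨R, hR⟩ := hsol.norm_state_le hproj hΩU hAB hL hLpos heq hU hF hΩ
  have hR0 : 0 ≤ R := (norm_nonneg _).trans (hR 0 le_rfl)
  refine ⟨R + C, by positivity, fun a b ha hab => ?_⟩
  rw [hsol.output a ha, hsol.output b (ha.trans hab)]
  refine (hproj.norm_sub_le _ _).trans
    ((AbsolutelyContinuousOnInterval.mono_of_nonneg hsol.ac_y ha
      hab).norm_sub_le_of_ae_hasDerivAt hab ?_)
  filter_upwards [ae_restrict_Icc_of_Ici ha hC] with t ht
  obtain ⟨⟨b', hb, hy⟩, htI⟩ := ht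
  refine ⟨_, ?_, hy⟩
  have h1 := norm_add_le (-(y t)) b'
  rw [norm_neg] at h1
  linarith [hR t (ha.trans htI.1)]

theorem IsProjectedFlow.tendsto_output (hU : IsOpen U) (hF : StrictConvexOn ℝ U F)
    (hΩ : IsClosed Ω) : Tendsto x atTop (𝓝 c) := by
  have hcΩ : c ∈ Ω := heq.proj_eq ▸ hproj.mem _
  obtain ⟨M, hM0, hM⟩ := hsol.exists_lipschitz_output hproj hΩU hAB hL hLpos heq hU
    hF.convexOn hΩ
  obtain ⟨R, hR⟩ := hsol.norm_output_le hproj hΩU hAB hL hLpos heq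
  rw [Metric.tendsto_atTop]
  intro ε hε
  have hcont : ContinuousOn (subgradientGap F c gs) U :=
    ((hF.convexOn.continuousOn hU).sub continuousOn_const).sub (by fun_prop)
  -- The gap is continuous and positive on a compact set that excludes `c`, so its minimum serves as
  -- `κ`.
  obtain ⟨κ, hκ0, hκ⟩ : ∃ κ > 0, ∀ v ∈ Ω, ‖v‖ ≤ R → ε / 2 ≤ ‖v - c‖ →
      κ ≤ subgradientGap F c gs v := by
    set K := Metric.closedBall (0 : E) R ∩ (Ω ∩ {v | ε / 2 ≤ ‖v - c‖}) with hKdef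
    have hK : IsCompact K := (isCompact_closedBall _ _).inter_right
      (hΩ.inter (isClosed_le continuous_const (by fun_prop)))
    rcases K.eq_empty_or_nonempty with h0 | hne
    · refine ⟨1, one_pos, fun v h1 h2 h3 => ?_⟩
      have : v ∈ K := ⟨by simpa using h2, h1, h3⟩
      simp [h0] at this
    · obtain ⟨v₀, hv₀, hmin⟩ := hK.exists_isMinOn hne
        (hcont.mono fun v hv => hΩU hv.2.1)
      refine ⟨_, subgradientGap_pos hF (hΩU hcΩ) heq.isSubgradientOn (hΩU hv₀.2.1) ?_,
        fun v h1 h2 h3 => hmin ⟨by simpa using h2, h1, h3⟩⟩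
      rintro rfl
      have := hv₀.2.2
      simp only [Set.mem_ofPred_eq, sub_self, norm_zero] at this
      linarith
  set V := fun t => flowEnergy proj c ls zs (y t) (lam t) (z t) with hV
  -- During a time `δ` the output moves at most `ε / 2`; `M + 1` avoids division by zero.
  set δ := ε / (2 * (M + 1)) with hδ
  have hδ0 : 0 < δ := by positivity
  have hVpos : ∀ t, 0 ≤ V t := by
    intro t
    have hid : IsProjectionMap (Set.univ : Set G) (fun u => u) := .of_univ
    have h2 := hproj.norm_sq_le_projEnergy hcΩ (y t)
    have h3 := hid.norm_sq_le_projEnergy (Set.mem_univ ls) (lam t)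
    have h4 := hid.norm_sq_le_projEnergy (Set.mem_univ zs) (z t)
    simp only [hV, flowEnergy]
    have := sq_nonneg ‖proj (y t) - c‖
    have := sq_nonneg ‖lam t - ls‖
    have := sq_nonneg ‖z t - zs‖
    linarith
  have hanti := flowEnergy_antitoneOn hproj hΩU hAB hL hLpos heq hsol
  -- Choose a time after which the energy stays within `κ * δ` of its infimum.
  have hbdd : BddBelow (V '' Set.Ici 0) := ⟨0, by rintro _ ⟨t, -, rfl⟩; exact hVpos t⟩
  obtain ⟨_, ⟨N, hN, rfl⟩, hN'⟩ := Real.lt_sInf_add_pos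
    (s := V '' Set.Ici 0) ⟨_, 0, Set.mem_Ici.2 le_rfl, rfl⟩ (mul_pos hκ0 hδ0)
  refine ⟨N, fun t ht => ?_⟩
  have hN0 : (0 : ℝ) ≤ N := hN
  have ht0 : 0 ≤ t := hN0.trans ht
  by_contra! hfar
  rw [dist_eq_norm] at hfar
  have h1 := flowEnergy_add_le hproj hΩU hAB hL hLpos heq hsol (κ := κ) ht0
    (le_add_of_nonneg_right hδ0.le) fun s hs => by
      have hs0 : 0 ≤ s := ht0.trans hs.1
      refine hκ _ (hsol.output s hs0 ▸ hproj.mem _) (hR s hs0).1 ?_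
      have h2 := hM t s ht0 hs.1
      have h3 : M * (s - t) ≤ ε / 2 := by
        have h4 : M * (s - t) ≤ (M + 1) * δ :=
          mul_le_mul (by linarith) (by linarith [hs.2]) (by linarith [hs.1]) (by linarith)
        have h5 : (M + 1) * δ = ε / 2 := by
          rw [hδ]
          field_simp
        linarith
      have h6 := norm_sub_le_norm_sub_add_norm_sub (x t) (x s) c
      rw [norm_sub_rev (x t) (x s)] at h6
      linarith
  have h2 : V t ≤ V N := hanti hN (Set.mem_Ici.2 ht0) ht
  have h3 : sInf (V '' Set.Ici 0) ≤ V (t + δ) :=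
    csInf_le hbdd ⟨t + δ, Set.mem_Ici.2 (by linarith), rfl⟩
  rw [add_sub_cancel_left] at h1
  have h4 : V (t + δ) + κ * δ ≤ V t := h1
  linarith

end Bounds

end Flow

/-! ### Blockwise projections and derivatives, and the graph Laplacian -/

theorem IsProjection.inner_nonpos {k : ℕ} {Ω : Set (Vec k)} (hconv : Convex ℝ Ω) {u v w : Vec k}
    (h : IsProjection Ω u v) (hw : w ∈ Ω) : ⟪u - v, w - v⟫ ≤ 0 := by
  have : Nonempty Ω := ⟨⟨v, h.1⟩⟩
  refine (norm_eq_iInf_iff_real_inner_le_zero hconv h.1).1 (le_antisymm ?_ ?_) w hw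
  · exact le_ciInf fun w => h.2 w w.2
  · exact ciInf_le ⟨0, by rintro _ ⟨w, rfl⟩; exact norm_nonneg _⟩ (⟨v, h.1⟩ : Ω)

theorem hasDerivAt_piLp_two {ι : Type*} [Fintype ι] {E : ι → Type*}
    [∀ i, NormedAddCommGroup (E i)] [∀ i, NormedSpace ℝ (E i)] {f : ℝ → PiLp 2 E}
    {f' : PiLp 2 E} {t : ℝ} (h : ∀ i, HasDerivAt (fun s => f s i) (f' i) t) :
    HasDerivAt f f' t := by
  have h1 : HasDerivAt (fun s => (f s).ofLp) f'.ofLp t := hasDerivAt_pi.2 h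
  exact ((PiLp.continuousLinearEquiv 2 ℝ E).symm.toContinuousLinearMap.hasFDerivAt
    (x := (f t).ofLp)).comp_hasDerivAt t h1

namespace WeightedGraph

variable {n : ℕ} (G : WeightedGraph n)

/-- The weighted graph Laplacian acting on stacked vectors. -/
noncomputable def laplacian (m : ℕ) :
    Stacked (fun _ : Fin n => m) →ₗ[ℝ] Stacked (fun _ : Fin n => m) where
  toFun u := WithLp.toLp 2 fun i => ∑ j, G.a i j • (u i - u j)
  map_add' u v := by
    ext1 i
    simp only [PiLp.add_apply, ← Finset.sum_add_distrib, ← smul_add]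
    exact Finset.sum_congr rfl fun j _ => by congr 1; abel
  map_smul' r u := by
    ext1 i
    simp only [PiLp.smul_apply, RingHom.id_apply, Finset.smul_sum]
    exact Finset.sum_congr rfl fun j _ => by rw [← smul_sub, smul_comm]

theorem laplacian_apply {m : ℕ} (u : Stacked (fun _ : Fin n => m)) (i : Fin n) :
    G.laplacian m u i = ∑ j, G.a i j • (u i - u j) := rfl

/-- Summation by parts: exchanging `i` and `j` and using symmetric weights averages the two forms of
the sum, hence the factor 2. -/
theorem two_mul_inner_laplacian {m : ℕ} (u v : Stacked (fun _ : Fin n => m)) :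
    2 * ⟪G.laplacian m u, v⟫ = ∑ i, ∑ j, G.a i j * ⟪u i - u j, v i - v j⟫ := by
  have h1 : ⟪G.laplacian m u, v⟫ = ∑ i, ∑ j, G.a i j * ⟪u i - u j, v i⟫ := by
    rw [PiLp.inner_apply]
    refine Finset.sum_congr rfl fun i _ => ?_
    rw [laplacian_apply, sum_inner]
    exact Finset.sum_congr rfl fun j _ => real_inner_smul_left _ _ _
  have h2 : ∑ i, ∑ j, G.a i j * ⟪u i - u j, v i⟫ = ∑ i, ∑ j, G.a i j * -⟪u i - u j, v j⟫ := by
    rw [Finset.sum_comm]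
    refine Finset.sum_congr rfl fun i _ => Finset.sum_congr rfl fun j _ => ?_
    rw [G.symm, ← inner_neg_left, neg_sub]
  rw [two_mul, h1]
  nth_rw 2 [h2]
  simp only [← Finset.sum_add_distrib, ← mul_add]
  simp only [inner_sub_right, sub_eq_add_neg (⟪_, _⟫)]

theorem laplacian_isSymmetric (m : ℕ) : (G.laplacian m).IsSymmetric := by
  intro u v
  have h1 := G.two_mul_inner_laplacian u v
  have h2 := G.two_mul_inner_laplacian v u
  have h3 : ∑ i, ∑ j, G.a i j * ⟪u i - u j, v i - v j⟫
      = ∑ i, ∑ j, G.a i j * ⟪v i - v j, u i - u j⟫ := by simp only [real_inner_comm]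
  rw [real_inner_comm u] at h2
  linarith

theorem inner_laplacian_self_nonneg {m : ℕ} (u : Stacked (fun _ : Fin n => m)) :
    0 ≤ ⟪G.laplacian m u, u⟫ := by
  have h1 := G.two_mul_inner_laplacian u u
  have h2 : 0 ≤ ∑ i, ∑ j, G.a i j * ⟪u i - u j, u i - u j⟫ :=
    Finset.sum_nonneg fun i _ => Finset.sum_nonneg fun j _ =>
      mul_nonneg (G.nonneg i j) real_inner_self_nonneg
  linarith

theorem eq_of_laplacian_eq_zero (hG : G.toSimpleGraph.Connected) {m : ℕ}
    {u : Stacked (fun _ : Fin n => m)} (hu : G.laplacian m u = 0) (i j : Fin n) : u i = u j := by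
  have h1 := G.two_mul_inner_laplacian u u
  rw [hu, inner_zero_left, mul_zero] at h1
  have hpos : ∀ i j, 0 ≤ G.a i j * ⟪u i - u j, u i - u j⟫ := fun i j =>
    mul_nonneg (G.nonneg i j) real_inner_self_nonneg
  have hadj : ∀ i j, G.toSimpleGraph.Adj i j → u i = u j := by
    intro i j hij
    have h2 := (Finset.sum_eq_zero_iff_of_nonneg fun i _ =>
      Finset.sum_nonneg fun j _ => hpos i j).1 h1.symm i (Finset.mem_univ i)
    have h3 := (Finset.sum_eq_zero_iff_of_nonneg fun j _ => hpos i j).1 h2 j (Finset.mem_univ j)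
    rcases mul_eq_zero.1 h3 with h4 | h4
    · exact absurd h4 hij.2.ne'
    · exact sub_eq_zero.1 (inner_self_eq_zero.1 h4)
  obtain ⟨p⟩ := hG.preconnected i j
  induction p with
  | nil => rfl
  | cons h _ ih => exact (hadj _ _ h).trans ih

/-- For a connected graph, the range of the Laplacian contains the stacked vectors whose blocks
sum to zero. -/
theorem exists_laplacian_eq (hG : G.toSimpleGraph.Connected) {m : ℕ}
    {b : Stacked (fun _ : Fin n => m)} (hb : ∑ i, b i = 0) : ∃ z, G.laplacian m z = b := by
  change b ∈ (G.laplacian m).range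
  rw [← Submodule.orthogonal_orthogonal (G.laplacian m).range,
    -- By symmetry the range is the orthogonal complement of the kernel, and connectedness makes
    -- kernel vectors constant across nodes.
    (G.laplacian_isSymmetric m).orthogonal_range, Submodule.mem_orthogonal]
  intro u hu
  obtain ⟨i₀⟩ := hG.nonempty
  have h : ∀ i, u i = u i₀ := fun i => G.eq_of_laplacian_eq_zero hG hu i i₀
  rw [PiLp.inner_apply]
  simp only [h]
  rw [← inner_sum, hb, inner_zero_right]

end WeightedGraph

/-! ### The network problem as a projected flow -/

namespace EMOProblem

variable {n m : ℕ} {q : Fin n → ℕ} (P : EMOProblem n m q)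

/-- The product of the domains of the local objective functions. -/
def prodU : Set (Stacked q) := {x | ∀ i, x i ∈ P.U i}

/-- The block diagonal map `x ↦ (W_1 x_1, …, W_n x_n)`. -/
noncomputable def blockMap : Stacked q →ₗ[ℝ] Stacked (fun _ : Fin n => m) where
  toFun x := WithLp.toLp 2 fun i => (P.W i).toEuclideanLin (x i)
  map_add' x y := by ext1 i; simp
  map_smul' r x := by ext1 i; simp

/-- The block diagonal map `u ↦ (W_1ᵀ u_1, …, W_nᵀ u_n)`. -/
noncomputable def blockTranspose : Stacked (fun _ : Fin n => m) →ₗ[ℝ] Stacked q where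
  toFun u := WithLp.toLp 2 fun i => ((P.W i).transpose).toEuclideanLin (u i)
  map_add' x y := by ext1 i; simp
  map_smul' r x := by ext1 i; simp

/-- The constraint map as a linear map. -/
noncomputable def constraintLin : Stacked q →ₗ[ℝ] Vec m where
  toFun := P.constraintMap
  map_add' x y := by simp [constraintMap, Finset.sum_add_distrib]
  map_smul' r x := by simp [constraintMap, Finset.smul_sum]

theorem blockMap_apply (x : Stacked q) (i : Fin n) :
    P.blockMap x i = (P.W i).toEuclideanLin (x i) := rfl

theorem blockTranspose_apply (u : Stacked (fun _ : Fin n => m)) (i : Fin n) :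
    P.blockTranspose u i = ((P.W i).transpose).toEuclideanLin (u i) := rfl

theorem inner_blockMap (x : Stacked q) (u : Stacked (fun _ : Fin n => m)) :
    ⟪P.blockMap x, u⟫ = ⟪x, P.blockTranspose u⟫ := by
  rw [PiLp.inner_apply, PiLp.inner_apply]
  refine Finset.sum_congr rfl fun i _ => ?_
  rw [blockMap_apply, blockTranspose_apply, ← Matrix.conjTranspose_eq_transpose_of_trivial,
    Matrix.toEuclideanLin_conjTranspose_eq_adjoint, LinearMap.adjoint_inner_right]

theorem blockTranspose_const (μ : Vec m) :
    P.blockTranspose (WithLp.toLp 2 fun _ => μ) = P.constraintLin.adjoint μ := by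
  refine ext_inner_left ℝ fun x => ?_
  rw [← inner_blockMap, LinearMap.adjoint_inner_right, PiLp.inner_apply]
  change ∑ i, ⟪P.blockMap x i, μ⟫ = ⟪∑ i, P.blockMap x i, μ⟫
  rw [sum_inner]

theorem convex_prodΩ (h : ∀ i, Convex ℝ (P.Ω i)) : Convex ℝ P.prodΩ :=
  fun _ hx _ hy _ _ ha hb hab i => h i (hx i) (hy i) ha hb hab

theorem isClosed_prodΩ (h : ∀ i, IsClosed (P.Ω i)) : IsClosed P.prodΩ := by
  have : P.prodΩ = ⋂ i, (fun x : Stacked q => x i) ⁻¹' P.Ω i := by ext x; simp [prodΩ]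
  rw [this]
  exact isClosed_iInter fun i => (h i).preimage (by fun_prop)

theorem isOpen_prodU (h : ∀ i, IsOpen (P.U i)) : IsOpen P.prodU := by
  have : P.prodU = ⋂ i, (fun x : Stacked q => x i) ⁻¹' P.U i := by ext x; simp [prodU]
  rw [this]
  exact isOpen_iInter_of_finite fun i => (h i).preimage (by fun_prop)

theorem strictConvexOn_objective (h : ∀ i, StrictConvexOn ℝ (P.U i) (P.f i)) :
    StrictConvexOn ℝ P.prodU P.objective := by
  refine ⟨fun _ hx _ hy _ _ ha hb hab i => (h i).1 (hx i) (hy i) ha hb hab,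
    fun x hx y hy hxy a b ha hb hab => ?_⟩
  obtain ⟨i₀, hi₀⟩ : ∃ i, x i ≠ y i := by
    by_contra! hc
    exact hxy (PiLp.ext hc)
  simp only [objective, smul_eq_mul, Finset.mul_sum, ← Finset.sum_add_distrib]
  exact Finset.sum_lt_sum
    (fun i _ => (h i).convexOn.2 (hx i) (hy i) ha.le hb.le hab)
    ⟨i₀, Finset.mem_univ _, (h i₀).2 (hx i₀) (hy i₀) hi₀ ha hb hab⟩

theorem isSubgradientOn_objective {x g : Stacked q}
    (h : ∀ i, IsSubgradient (P.U i) (P.f i) (x i) (g i)) :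
    IsSubgradientOn P.prodU P.objective x g := by
  intro v hv
  rw [PiLp.inner_apply, objective, objective, ← Finset.sum_sub_distrib]
  exact Finset.sum_le_sum fun i _ => h i (v i) (hv i)

/-- The projection onto `Ω`, given blockwise by the projections onto the `Ω_i`. -/
theorem exists_isProjectionMap (hne : P.prodΩ.Nonempty) (hcl : ∀ i, IsClosed (P.Ω i))
    (hconv : ∀ i, Convex ℝ (P.Ω i)) :
    ∃ proj : Stacked q → Stacked q, IsProjectionMap P.prodΩ proj ∧
      ∀ u v : Stacked q, (∀ i, IsProjection (P.Ω i) (u i) (v i)) → v = proj u := by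
  obtain ⟨x₀, hx₀⟩ := hne
  have hex := fun i => existsUnique_isProjection ⟨x₀ i, hx₀ i⟩ (hcl i) (hconv i)
  choose p hp hp' using hex
  refine ⟨fun u => WithLp.toLp 2 fun i => p i (u i), ⟨fun u i => (hp i (u i)).1, ?_⟩, ?_⟩
  · intro u w hw
    rw [PiLp.inner_apply]
    exact Finset.sum_nonpos fun i _ => (hp i (u i)).inner_nonpos (hconv i) (hw i)
  · intro u v huv
    exact PiLp.ext fun i => hp' i (u i) (v i) (huv i)

variable {P}

theorem StandingAssumption.prodΩ_subset (hP : P.StandingAssumption) : P.prodΩ ⊆ P.prodU :=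
  fun _ hx i => hP.subset_U i (hx i)

theorem StandingAssumption.isOptimal_unique (hP : P.StandingAssumption) {x x' : Stacked q}
    (hx : P.IsOptimal x) (hx' : P.IsOptimal x') : x' = x := by
  have hconv : Convex ℝ P.feasible := (P.convex_prodΩ hP.convex_Ω).inter
    ((convex_singleton P.d₀).linear_preimage P.constraintLin)
  exact ((P.strictConvexOn_objective hP.strictConvex).subset
    (fun y hy => hP.prodΩ_subset hy.1) hconv).eq_of_isMinOn hx'.2 hx.2 hx'.1 hx.1

/-- All agents hold the same KKT multiplier, so the block transpose acts on it as the adjoint of the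
global constraint map, and the KKT inequality becomes the fixed-point equation for the projection.
The auxiliary `zs` absorbs the local mismatch between `d i` and the optimal `W_i x_i`. -/
theorem StandingAssumption.exists_isFlowEquilibrium (hP : P.StandingAssumption)
    {c : Stacked q} (hc : P.IsOptimal c) {d : Fin n → Vec m} (hd : ∑ i, d i = P.d₀)
    {proj : Stacked q → Stacked q} (hproj : IsProjectionMap P.prodΩ proj) :
    ∃ gs ls zs, IsFlowEquilibrium P.prodU P.objective proj P.blockMap P.blockTranspose
      (P.graph.laplacian m) (WithLp.toLp 2 d) c gs ls zs := by
  obtain ⟨s, hs, hsd⟩ := hP.slater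
  obtain ⟨g, μ, hg, hμ⟩ := exists_multiplier_of_isMinOn (W := P.constraintLin) (b := P.d₀)
    (P.isOpen_prodU hP.isOpen_U) (P.strictConvexOn_objective hP.strictConvex).convexOn
    hP.prodΩ_subset (P.convex_prodΩ hP.convex_Ω) hc.1.1 hc.1.2
    (fun x hx hxb => hc.2 (show x ∈ P.feasible from ⟨hx, hxb⟩)) hs hsd
  obtain ⟨zs, hzs⟩ := P.graph.exists_laplacian_eq hP.connected
    (b := WithLp.toLp 2 d - P.blockMap c) (by
      have : ∑ i, P.blockMap c i = P.d₀ := hc.1.2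
      simp only [PiLp.sub_apply, Finset.sum_sub_distrib, this, hd, sub_self])
  refine ⟨g, WithLp.toLp 2 fun _ => μ, zs, hg, ?_, ?_, ?_⟩
  · refine hproj.eq_of_inner_nonpos hc.1.1 fun w hw => ?_
    have h1 := hμ w hw
    rw [blockTranspose_const]
    have h2 : c - g + P.constraintLin.adjoint μ - c = -(g - P.constraintLin.adjoint μ) := by abel
    rw [h2, inner_neg_left]
    linarith
  · ext1 i
    simp [WeightedGraph.laplacian_apply]
  · rw [hzs]
    abel

theorem IsDPOFASolution.isProjectedFlow {d : Fin n → Vec m} {y x : ℝ → Stacked q}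
    {lam z : ℝ → Stacked (fun _ : Fin n => m)} (h : P.IsDPOFASolution d y x lam z)
    {proj : Stacked q → Stacked q}
    (hproj : ∀ u v : Stacked q, (∀ i, IsProjection (P.Ω i) (u i) (v i)) → v = proj u) :
    IsProjectedFlow P.prodU P.objective proj P.blockMap P.blockTranspose
      (P.graph.laplacian m) (WithLp.toLp 2 d) y x lam z where
  ac_y := h.ac_y
  ac_lam := h.ac_lam
  ac_z := h.ac_z
  output t ht := hproj _ _ (h.output t ht)
  deriv_y := by
    filter_upwards [h.deriv_y] with t ht
    choose g hg hy using ht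
    exact ⟨WithLp.toLp 2 g, P.isSubgradientOn_objective hg, hasDerivAt_piLp_two hy⟩
  deriv_lam := h.deriv_lam.mono fun t ht => hasDerivAt_piLp_two ht
  deriv_z := h.deriv_z.mono fun t ht => hasDerivAt_piLp_two ht

end EMOProblem

theorem theorem2 {n m : ℕ} {q : Fin n → ℕ} (P : EMOProblem n m q)
    (hP : P.StandingAssumption)
    -- the problem has an optimal solution
    (hopt : ∃ xstar, P.IsOptimal xstar)
    (d : Fin n → Vec m) (hd : ∑ i, d i = P.d₀) :
    ∃ xstar, P.IsOptimal xstar ∧ (∀ x', P.IsOptimal x' → x' = xstar) ∧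
      ∀ (y x : ℝ → Stacked q) (lam z : ℝ → Stacked (fun _ : Fin n => m)),
        P.IsDPOFASolution d y x lam z →
          (∃ C : ℝ, ∀ t : ℝ, 0 ≤ t → ‖y t‖ ≤ C ∧ ‖x t‖ ≤ C ∧ ‖lam t‖ ≤ C ∧ ‖z t‖ ≤ C) ∧
          Tendsto x atTop (𝓝 xstar) := by
  obtain ⟨c, hc⟩ := hopt
  refine ⟨c, hc, fun x' hx' => hP.isOptimal_unique hc hx', fun y x lam z hsol => ?_⟩
  obtain ⟨proj, hproj, huniq⟩ := P.exists_isProjectionMap ⟨c, hc.1.1⟩ hP.isClosed_Ω hP.convex_Ω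
  obtain ⟨gs, ls, zs, heq⟩ := hP.exists_isFlowEquilibrium hc hd hproj
  have hflow := hsol.isProjectedFlow huniq
  have hU := P.isOpen_prodU hP.isOpen_U
  have hF := P.strictConvexOn_objective hP.strictConvex
  have hΩ := P.isClosed_prodΩ hP.isClosed_Ω
  have hsymm := P.graph.laplacian_isSymmetric m
  have hpos := P.graph.inner_laplacian_self_nonneg (m := m)
  obtain ⟨R₁, hR₁⟩ := hflow.norm_output_le hproj hP.prodΩ_subset P.inner_blockMap hsymm hpos heq
  obtain ⟨R₂, hR₂⟩ := hflow.norm_state_le hproj hP.prodΩ_subset P.inner_blockMap hsymm hpos heq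
    hU hF.convexOn hΩ
  refine ⟨⟨max R₁ R₂, fun t ht => ?_⟩, hflow.tendsto_output hproj hP.prodΩ_subset
    P.inner_blockMap hsymm hpos heq hU hF hΩ⟩
  obtain ⟨hx, hl, hz⟩ := hR₁ t ht
  exact ⟨le_max_of_le_right (hR₂ t ht), le_max_of_le_left hx, le_max_of_le_left hl,
    le_max_of_le_left hz⟩
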